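/- \textbf{Theorem (Hardy's theorem for Hermite expansions).} Let $n\ge 1$ and let $H=-\Delta+|x|^2$ be the Hermite operator on $L^2(\mathbb R^n)$ (complex-valued functions), in its self-adjoint realisation, i.e. the adjoint of $-\Delta+|x|^2$ on the Schwartz space. For $k=0,1,2,\dots$ let $P_k$ be the orthogonal projection of $L^2(\mathbb R^n)$ onto the eigenspace $\{f\in L^2(\mathbb R^n): Hf=(2k+n)f\}$. Let $f\in L^2(\mathbb R^n)$, $a,b>0$ and a constant $C$ be such that $$|f(x)|\le C\,e^{-\frac12 a|x|^2}\quad\text{for almost every } x\in\mathbb R^n,$$ $$\|P_kf\|_2\le C\,e^{-\frac12 b(2k+n)}\quad\text{for all } k\ge 0.$$ If $a\tanh b>1$, then $f=0$ (almost everywhere). -/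

import Mathlib

open MeasureTheory
open scoped SchwartzMap Laplacian InnerProductSpace

noncomputable section

namespace HermiteExpansion

/-- The complex Hilbert space `L²(ℝⁿ)` with respect to Lebesgue measure. -/
abbrev L2 (n : ℕ) : Type := Lp ℂ 2 (volume : Measure (EuclideanSpace ℝ (Fin n)))

/-- The Hermite operator `H = -Δ + |x|²` on Schwartz functions. -/
def hermiteOp (n : ℕ) (φ : 𝓢(EuclideanSpace ℝ (Fin n), ℂ)) : 𝓢(EuclideanSpace ℝ (Fin n), ℂ) :=
  -(Δ φ) + SchwartzMap.smulLeftCLM ℂ (fun x : EuclideanSpace ℝ (Fin n) => ‖x‖ ^ 2) φ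

theorem hermiteOp_apply (n : ℕ) (φ : 𝓢(EuclideanSpace ℝ (Fin n), ℂ))
    (x : EuclideanSpace ℝ (Fin n)) :
    hermiteOp n φ x =
      -(Δ (φ : EuclideanSpace ℝ (Fin n) → ℂ) x) + ((‖x‖ ^ 2 : ℝ) : ℂ) * φ x := by
  have h := SchwartzMap.smulLeftCLM_apply_apply (F := ℂ)
    (Function.hasTemperateGrowth_norm_sq (H := EuclideanSpace ℝ (Fin n))) φ x
  simp only [hermiteOp, _root_.add_apply, _root_.neg_apply,
    SchwartzMap.laplacian_apply, h, Complex.real_smul]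

/-- The eigenspace in `L²(ℝⁿ)` of the Hermite operator `H` with eigenvalue `μ`: the functions
`f ∈ L²(ℝⁿ)` that lie in the domain of the adjoint of `H` on Schwartz functions (which is the
self-adjoint realisation of `H`, that is, `Hf` taken in the sense of distributions) and satisfy
`Hf = μ f`. -/
def hermiteEigenspace (n : ℕ) (μ : ℝ) : ClosedSubmodule ℂ (L2 n) where
  carrier := {f | ∀ φ : 𝓢(EuclideanSpace ℝ (Fin n), ℂ),
    ⟪(hermiteOp n φ).toLp 2 volume, f⟫_ℂ = (μ : ℂ) * ⟪φ.toLp 2 volume, f⟫_ℂ}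
  add_mem' := by
    intro f g hf hg φ
    rw [inner_add_right, inner_add_right, hf φ, hg φ, mul_add]
  zero_mem' := by
    intro φ
    simp
  smul_mem' := by
    intro c f hf φ
    rw [inner_smul_right, inner_smul_right, hf φ, mul_left_comm]
  isClosed' := by
    simp only [Set.ofPred_forall]
    exact isClosed_iInter fun φ => isClosed_eq (by fun_prop) (by fun_prop)

/-- `P_k`: the orthogonal projection of `L²(ℝⁿ)` onto the eigenspace of the Hermite operator
with eigenvalue `2k + n`. -/
def hermiteProj (n k : ℕ) : L2 n →L[ℂ] L2 n :=
  (hermiteEigenspace n (2 * (k : ℝ) + (n : ℝ))).toSubmodule.starProjection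

end HermiteExpansion

end

/-! Testing `f` along one direction at a time reduces the theorem to one complex variable. For a
unit vector `w`, applying the creation operator k times to the Gaussian gives an eigenfunction of
`H` for `2k + n`, of norm `√(2 ^ k * k!)` times that of the Gaussian. So its pairing with `f` only
sees `P_k f`, and is O(`e ^ (-bk) √(2 ^ k * k!)`). The exponential generating function G_w of these
pairings is therefore entire, of order two and type at most `q' / 4` for any `q' > e ^ (-2b)`
(`norm_genFun_le`).

Summing the series under the integral turns G_w(z) into the integral of `exp (z⟪w, x⟫ - z² / 4 -
‖x‖² / 2)` against the conjugate of `f` (`genFun_hermiteCoeff`). For real z = t the pointwise bound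
on `f` makes it O(`exp (-(a - 1) / (4 (a + 1)) t²)`).

The condition `a tanh b > 1` says exactly `e ^ (-2b) < (a - 1) / (a + 1)`: the decay on the real
axis beats the type, and Phragmén–Lindelöf (`eq_zero_of_gaussian_decay`) forces G_w = 0. At
imaginary z this says that the Fourier transform of the Gaussian times the conjugate of `f` vanishes
along every line through 0, so `f = 0`. -/

namespace HermiteExpansion

/-! ### Phragmén–Lindelöf in sectors -/

/-- Phragmén–Lindelöf principle in a sector of angle less than `π / 2` for entire functions of
order two and finite type. -/
theorem norm_le_on_sector {G : ℂ → ℂ} (hG : Differentiable ℂ G) {M B C α β : ℝ}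
    (hM : ∀ z, ‖G z‖ ≤ M * Real.exp (B * ‖z‖ ^ 2)) (hαβ : α < β) (hβα : β - α < Real.pi / 2)
    (hα : ∀ r : ℝ, 0 < r → ‖G (r * Complex.exp (α * Complex.I))‖ ≤ C)
    (hβ : ∀ r : ℝ, 0 < r → ‖G (r * Complex.exp (β * Complex.I))‖ ≤ C)
    {r θ : ℝ} (hr : 0 < r) (h1 : α ≤ θ) (h2 : θ ≤ β) :
    ‖G (r * Complex.exp (θ * Complex.I))‖ ≤ C := by
  have key : ∀ ζ : ℂ, Complex.exp ζ = (Real.exp ζ.re : ℝ) * Complex.exp (ζ.im * Complex.I) := by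
    intro ζ
    rw [Complex.ofReal_exp, ← Complex.exp_add, Complex.re_add_im]
  -- The exponential maps a strip of width `β - α` onto the sector. Order two becomes growth `exp
  -- (|B| e ^ (2|Re ζ|))`, admissible because `2 < π / (β - α)`.
  have hmain := PhragmenLindelof.horizontal_strip (f := fun ζ => G (Complex.exp ζ)) (C := C)
    (a := α) (b := β) (z := Real.log r + θ * Complex.I)
    (hG.comp Complex.differentiable_exp).diffContOnCl
    ⟨2, by rw [lt_div_iff₀ (by linarith)]; linarith, |B|, by
      apply Asymptotics.IsBigO.of_bound |M|
      refine Filter.Eventually.of_forall fun ζ => ?_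
      refine (hM _).trans ?_
      rw [Real.norm_eq_abs, abs_of_pos (Real.exp_pos _), Complex.norm_exp]
      gcongr
      · exact le_abs_self M
      · exact le_abs_self B
      · rw [← Real.exp_nat_mul]
        push_cast
        gcongr
        exact le_abs_self _⟩
    (fun ζ hζ => by
      change ‖G (Complex.exp ζ)‖ ≤ C
      rw [key, hζ]; exact hα _ (Real.exp_pos _))
    (fun ζ hζ => by
      change ‖G (Complex.exp ζ)‖ ≤ C
      rw [key, hζ]; exact hβ _ (Real.exp_pos _))
    (by simpa using h1) (by simpa using h2)
  simpa [Complex.exp_add, ← Complex.ofReal_log hr.le, ← Complex.ofReal_exp, Real.exp_log hr]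
    using hmain

/-- The weighted form of `norm_le_on_sector`, with a bound by a trigonometrically linear
indicator. -/
theorem norm_le_exp_on_sector {G : ℂ → ℂ} (hG : Differentiable ℂ G) {M B C α β p q : ℝ}
    (hM : ∀ z, ‖G z‖ ≤ M * Real.exp (B * ‖z‖ ^ 2)) (hαβ : α < β) (hβα : β - α < Real.pi / 2)
    (hα : ∀ r : ℝ, 0 < r → ‖G (r * Complex.exp (α * Complex.I))‖ ≤
      C * Real.exp ((p * Real.cos (2 * α) + q * Real.sin (2 * α)) * r ^ 2))
    (hβ : ∀ r : ℝ, 0 < r → ‖G (r * Complex.exp (β * Complex.I))‖ ≤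
      C * Real.exp ((p * Real.cos (2 * β) + q * Real.sin (2 * β)) * r ^ 2))
    {r θ : ℝ} (hr : 0 < r) (h1 : α ≤ θ) (h2 : θ ≤ β) :
    ‖G (r * Complex.exp (θ * Complex.I))‖ ≤
      C * Real.exp ((p * Real.cos (2 * θ) + q * Real.sin (2 * θ)) * r ^ 2) := by
  -- Chosen so that `Re (c z²) = (p cos 2θ + q sin 2θ) r²`; dividing by `exp (c z²)` reduces to a
  -- constant bound.
  set c : ℂ := p - q * Complex.I with hc
  have hnorm : ∀ r θ : ℝ, ‖Complex.exp (-(c * (r * Complex.exp (θ * Complex.I)) ^ 2))‖ =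
      Real.exp (-((p * Real.cos (2 * θ) + q * Real.sin (2 * θ)) * r ^ 2)) := by
    intro r θ
    rw [Complex.norm_exp, mul_pow, ← Complex.exp_nat_mul]
    have : ((2 : ℕ) : ℂ) * (θ * Complex.I) = ((2 * θ : ℝ) : ℂ) * Complex.I := by push_cast; ring
    rw [this, Complex.exp_mul_I, ← Complex.ofReal_cos, ← Complex.ofReal_sin, ← Complex.ofReal_pow,
      hc]
    congr 1
    simp only [Complex.neg_re, Complex.mul_re, Complex.mul_im, Complex.sub_re, Complex.sub_im,
      Complex.add_re, Complex.add_im, Complex.ofReal_re, Complex.ofReal_im, Complex.I_re,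
      Complex.I_im]
    ring
  have hiff : ∀ r θ : ℝ, ‖G (r * Complex.exp (θ * Complex.I)) *
        Complex.exp (-(c * (r * Complex.exp (θ * Complex.I)) ^ 2))‖ ≤ C ↔
      ‖G (r * Complex.exp (θ * Complex.I))‖ ≤
      C * Real.exp ((p * Real.cos (2 * θ) + q * Real.sin (2 * θ)) * r ^ 2) := by
    intro r θ
    rw [norm_mul, hnorm, Real.exp_neg, ← div_eq_mul_inv, div_le_iff₀ (Real.exp_pos _)]
  rw [← hiff]
  refine norm_le_on_sector (G := fun z => G z * Complex.exp (-(c * z ^ 2))) (by fun_prop)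
    (M := M) (B := B + ‖c‖) ?_ hαβ hβα (fun r hr => (hiff r α).2 (hα r hr))
    (fun r hr => (hiff r β).2 (hβ r hr)) hr h1 h2
  intro z
  rw [norm_mul, add_mul, Real.exp_add, ← mul_assoc]
  have hM0 : 0 ≤ M * Real.exp (B * ‖z‖ ^ 2) := (norm_nonneg _).trans (hM z)
  refine mul_le_mul (hM z) ?_ (norm_nonneg _) hM0
  refine (Complex.norm_exp_le_exp_norm _).trans ?_
  rw [norm_neg, norm_mul, norm_pow]

/-- An entire function of order two and type at most `β` which decays like `exp (-α x ^ 2)` with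
`α > β` on the positive real axis vanishes identically. -/
theorem eq_zero_of_gaussian_decay {F : ℂ → ℂ} (hF : Differentiable ℂ F) {C α β : ℝ}
    (hβ : ∀ z, ‖F z‖ ≤ C * Real.exp (β * ‖z‖ ^ 2))
    (hα : ∀ x : ℝ, 0 < x → ‖F x‖ ≤ C * Real.exp (-α * x ^ 2)) (hαβ : β < α) : F = 0 := by
  have hpi := Real.pi_pos
  -- This indicator equals `β` at both ends, `π / 4` and `π / 2`.
  have step1 : ∀ r θ : ℝ, 0 < r → Real.pi / 4 ≤ θ → θ ≤ Real.pi / 2 →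
      ‖F (r * Complex.exp (θ * Complex.I))‖ ≤
      C * Real.exp ((-β * Real.cos (2 * θ) + β * Real.sin (2 * θ)) * r ^ 2) := by
    intro r θ hr h1 h2
    refine norm_le_exp_on_sector hF hβ (by linarith) (by linarith) ?_ ?_ hr h1 h2
    · intro r hr
      have e : 2 * (Real.pi / 4) = Real.pi / 2 := by ring
      rw [e]
      have := hβ (r * Complex.exp ((Real.pi / 4 : ℝ) * Complex.I))
      rw [norm_mul, Complex.norm_exp_ofReal_mul_I, mul_one, Complex.norm_real, Real.norm_eq_abs,
        sq_abs] at this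
      simpa using this
    · intro r hr
      have e : 2 * (Real.pi / 2) = Real.pi := by ring
      rw [e]
      have := hβ (r * Complex.exp ((Real.pi / 2 : ℝ) * Complex.I))
      rw [norm_mul, Complex.norm_exp_ofReal_mul_I, mul_one, Complex.norm_real, Real.norm_eq_abs,
        sq_abs] at this
      simpa using this
  have step2 : ∀ r K : ℝ, 0 < r → 0 < K →
      ‖F (r * Complex.exp ((Real.pi / 4 : ℝ) * Complex.I))‖ ≤
        C * Real.exp ((β - K) * r ^ 2) := by
    intro r K hr hK
    -- The sector must be narrower than `π / 2`, so it stops at `π / 2 - t / 2`. This `t` makes the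
    -- indicator with `p = -α`, `q = β - K` agree there with that of `step1`; at `π / 4` it equals
    -- `β - K`, with `K` arbitrary.
    set t := Real.arctan ((α - β) / K) with ht
    have ht0 : 0 < t := by
      rw [ht, Real.arctan_pos]
      exact div_pos (by linarith) hK
    have ht1 : t < Real.pi / 2 := Real.arctan_lt_pi_div_two _
    have hc : 0 < Real.cos t := Real.cos_arctan_pos _
    have htan : K * Real.sin t = (α - β) * Real.cos t := by
      have := Real.tan_arctan ((α - β) / K)
      rw [← ht, Real.tan_eq_sin_div_cos, div_eq_div_iff hc.ne' hK.ne'] at this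
      linarith
    have := norm_le_exp_on_sector (p := -α) (q := β - K) (α := 0)
      (β := Real.pi / 2 - t / 2) (C := C) hF hβ (by linarith) (by linarith) ?_ ?_ hr
      (θ := Real.pi / 4) (by linarith) (by linarith)
    · have e : 2 * (Real.pi / 4) = Real.pi / 2 := by ring
      rw [e] at this
      simpa using this
    · intro r hr
      simpa using hα r hr
    · intro r hr
      refine (step1 r (Real.pi / 2 - t / 2) hr (by linarith) (by linarith)).trans_eq ?_
      have e : 2 * (Real.pi / 2 - t / 2) = Real.pi - t := by ring
      rw [e, Real.cos_pi_sub, Real.sin_pi_sub]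
      congr 3
      linear_combination htan
  have hzero : ∀ r : ℝ, 0 < r → F (r * Complex.exp ((Real.pi / 4 : ℝ) * Complex.I)) = 0 := by
    intro r hr
    rw [← norm_le_zero_iff]
    have hlim : Filter.Tendsto (fun K : ℝ => C * Real.exp ((β - K) * r ^ 2)) Filter.atTop
        (nhds (C * 0)) := by
      refine (Real.tendsto_exp_atBot.comp ?_).const_mul C
      refine Filter.Tendsto.atBot_mul_const (by positivity) ?_
      exact Filter.tendsto_atBot_add_const_left _ β Filter.tendsto_neg_atTop_atBot
    rw [mul_zero] at hlim
    exact ge_of_tendsto hlim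
      ((Filter.eventually_gt_atTop 0).mono fun K hK => step2 r K hr hK)
  set e : ℂ := Complex.exp ((Real.pi / 4 : ℝ) * Complex.I) with he
  have he0 : e ≠ 0 := Complex.exp_ne_zero _
  have hFan : AnalyticOnNhd ℂ F Set.univ := hF.differentiableOn.analyticOnNhd isOpen_univ
  refine hFan.eq_of_frequently_eq (z₀ := e) (analyticOnNhd_const (v := (0 : ℂ))) ?_
  have htend : Filter.Tendsto (fun r : ℝ => (r : ℂ) * e) (nhdsWithin 1 {1}ᶜ)
      (nhdsWithin e {e}ᶜ) := by
    refine tendsto_nhdsWithin_iff.2 ⟨?_, ?_⟩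
    · refine tendsto_nhdsWithin_of_tendsto_nhds ?_
      have : ContinuousAt (fun r : ℝ => (r : ℂ) * e) 1 := by fun_prop
      simpa [ContinuousAt] using this
    · filter_upwards [self_mem_nhdsWithin] with r hr h
      apply hr
      have h' : (r : ℂ) * e = 1 * e := by rw [one_mul]; exact h
      exact_mod_cast mul_right_cancel₀ he0 h'
  refine htend.frequently (Filter.Eventually.frequently ?_)
  filter_upwards [nhdsWithin_le_nhds (lt_mem_nhds zero_lt_one)] with r hr
  exact hzero r hr

open scoped LineDeriv ContDiff

/-! ### The Gaussian and the ladder operators on Schwartz space -/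

section Schwartz

variable {E : Type*} [NormedAddCommGroup E] [InnerProductSpace ℝ E]

theorem pow_mul_exp_neg_sq_bounded (N : ℕ) {t : ℝ} (ht : 0 ≤ t) :
    (1 + t) ^ N * Real.exp (-(t ^ 2 / 2)) ≤ N.factorial * Real.exp (3 / 2) := by
  have h1 : (1 + t) ^ N ≤ N.factorial * Real.exp (1 + t) := by
    have := Real.pow_div_factorial_le_exp (1 + t) (by linarith) N
    rwa [div_le_iff₀ (by positivity), mul_comm] at this
  calc (1 + t) ^ N * Real.exp (-(t ^ 2 / 2))
      ≤ (N.factorial * Real.exp (1 + t)) * Real.exp (-(t ^ 2 / 2)) := by gcongr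
    _ = N.factorial * Real.exp (1 + t + -(t ^ 2 / 2)) := by rw [mul_assoc, ← Real.exp_add]
    _ ≤ N.factorial * Real.exp (3 / 2) := by
      gcongr
      nlinarith [sq_nonneg (t - 1)]

theorem hasTemperateGrowth_neg_norm_sq_div_two :
    (fun x : E => -(‖x‖ ^ 2 / 2)).HasTemperateGrowth := by
  have h := (Function.HasTemperateGrowth.const (E := E) (-(1 / 2) : ℝ)).mul
    (Function.hasTemperateGrowth_norm_sq E)
  have e : (fun x : E => -(‖x‖ ^ 2 / 2)) = (fun _ => -(1 / 2)) * fun x => ‖x‖ ^ 2 := by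
    funext x
    simp only [Pi.mul_apply]
    ring
  rw [e]
  exact h

theorem contDiff_exp_neg_norm_sq :
    ContDiff ℝ ∞ (fun x : E => Real.exp (-(‖x‖ ^ 2 / 2))) :=
  hasTemperateGrowth_neg_norm_sq_div_two.1.exp

theorem iteratedFDeriv_exp_neg_norm_sq_bounded (k m : ℕ) :
    ∃ C : ℝ, ∀ x : E, ‖x‖ ^ k *
      ‖iteratedFDeriv ℝ m (fun x : E => Real.exp (-(‖x‖ ^ 2 / 2))) x‖ ≤ C := by
  obtain ⟨l, K, hK, hl⟩ :=
    (hasTemperateGrowth_neg_norm_sq_div_two (E := E)).norm_iteratedFDeriv_le_uniform m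
  refine ⟨m.factorial * (K + 1) ^ m * ((k + l * m).factorial * Real.exp (3 / 2)), fun x => ?_⟩
  -- The composition bound wants `D ^ i` for the i-th inner derivative; a base at least 1 lets `D`
  -- itself be bounded by `D ^ i`.
  have h1 : 1 ≤ (K + 1) * (1 + ‖x‖) ^ l :=
    one_le_mul_of_one_le_of_one_le (by linarith) (one_le_pow₀ (by linarith [norm_nonneg x]))
  have hb := norm_iteratedFDeriv_comp_le (𝕜 := ℝ) (n := m) (N := ∞) Real.contDiff_exp
    (hasTemperateGrowth_neg_norm_sq_div_two (E := E)).1 (by exact_mod_cast le_top) x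
    (C := Real.exp (-(‖x‖ ^ 2 / 2))) (D := (K + 1) * (1 + ‖x‖) ^ l)
    (fun i _ => by
      rw [norm_iteratedFDeriv_eq_norm_iteratedDeriv, iteratedDeriv_eq_iterate,
        Real.iter_deriv_exp, Real.norm_eq_abs, Real.abs_exp])
    (fun i hi1 hi2 => (hl i hi2 x).trans (by
      refine le_trans ?_ (le_self_pow₀ h1 (by omega))
      gcongr
      linarith))
  calc ‖x‖ ^ k * ‖iteratedFDeriv ℝ m (fun x : E => Real.exp (-(‖x‖ ^ 2 / 2))) x‖
      ≤ (1 + ‖x‖) ^ k * (m.factorial * Real.exp (-(‖x‖ ^ 2 / 2)) * ((K + 1) * (1 + ‖x‖) ^ l) ^ m) := by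
        gcongr
        · linarith
        · exact hb
    _ = m.factorial * (K + 1) ^ m * ((1 + ‖x‖) ^ (k + l * m) * Real.exp (-(‖x‖ ^ 2 / 2))) := by
        rw [mul_pow, ← pow_mul, pow_add]; ring
    _ ≤ _ := mul_le_mul_of_nonneg_left (pow_mul_exp_neg_sq_bounded _ (norm_nonneg x))
        (by positivity)

variable (E) in
/-- The Gaussian `exp (-‖x‖ ^ 2 / 2)` as a Schwartz function. -/
noncomputable def gaussian : 𝓢(E, ℂ) where
  toFun x := (Real.exp (-(‖x‖ ^ 2 / 2)) : ℝ)
  smooth' := Complex.ofRealCLM.contDiff.comp contDiff_exp_neg_norm_sq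
  decay' k m := by
    obtain ⟨C, hC⟩ := iteratedFDeriv_exp_neg_norm_sq_bounded (E := E) k m
    refine ⟨C, fun x => ?_⟩
    have := Complex.ofRealLI.norm_iteratedFDeriv_comp_left (𝕜 := ℝ) (n := m) (i := m)
      (f := fun x : E => Real.exp (-(‖x‖ ^ 2 / 2))) (x := x)
      (contDiff_exp_neg_norm_sq.contDiffAt.of_le (by exact_mod_cast le_top)) le_rfl
    refine le_trans (le_of_eq ?_) (hC x)
    rw [← this]
    rfl

theorem gaussian_apply (x : E) : gaussian E x = (Real.exp (-(‖x‖ ^ 2 / 2)) : ℝ) := rfl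

/-- Multiplication of Schwartz functions by the linear form `⟪w, ·⟫`. -/
noncomputable def mulInner (w : E) : 𝓢(E, ℂ) →L[ℝ] 𝓢(E, ℂ) :=
  SchwartzMap.smulLeftCLM ℂ (fun x : E => ⟪w, x⟫_ℝ)

theorem hasTemperateGrowth_inner (w : E) : (fun x : E => ⟪w, x⟫_ℝ).HasTemperateGrowth :=
  (innerSL ℝ w).hasTemperateGrowth

theorem mulInner_apply (w : E) (φ : 𝓢(E, ℂ)) (x : E) :
    mulInner w φ x = ⟪w, x⟫_ℝ * φ x := by
  rw [mulInner, SchwartzMap.smulLeftCLM_apply_apply (hasTemperateGrowth_inner w),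
    Complex.real_smul]

variable (E) in
/-- Multiplication of Schwartz functions by `‖x‖ ^ 2`. -/
noncomputable def mulNormSq : 𝓢(E, ℂ) →L[ℝ] 𝓢(E, ℂ) :=
  SchwartzMap.smulLeftCLM ℂ (fun x : E => ‖x‖ ^ 2)

theorem mulNormSq_apply (φ : 𝓢(E, ℂ)) (x : E) :
    mulNormSq E φ x = ((‖x‖ ^ 2 : ℝ) : ℂ) * φ x := by
  rw [mulNormSq, SchwartzMap.smulLeftCLM_apply_apply (Function.hasTemperateGrowth_norm_sq E),
    Complex.real_smul]

theorem lineDerivOp_mulInner (v w : E) (φ : 𝓢(E, ℂ)) :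
    ∂_{v} (mulInner w φ) = ⟪w, v⟫_ℝ • φ + mulInner w (∂_{v} φ) := by
  ext x
  have hfun : (mulInner w φ : E → ℂ) = (innerSL ℝ w : E → ℝ) • (φ : E → ℂ) := by
    ext y; simp [mulInner_apply]
  have hd := ((innerSL ℝ w).hasFDerivAt (x := x)).smul (φ.hasFDerivAt x)
  rw [SchwartzMap.lineDerivOp_apply_eq_fderiv, hfun, hd.fderiv]
  simp [mulInner_apply, SchwartzMap.lineDerivOp_apply_eq_fderiv]
  ring

theorem lineDerivOp_mulNormSq (v : E) (φ : 𝓢(E, ℂ)) :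
    ∂_{v} (mulNormSq E φ) = (2 : ℝ) • mulInner v φ + mulNormSq E (∂_{v} φ) := by
  ext x
  have hfun : (mulNormSq E φ : E → ℂ) = (fun x : E => ‖x‖ ^ 2) • (φ : E → ℂ) := by
    ext y; simp [mulNormSq_apply]
  have hd := ((hasStrictFDerivAt_norm_sq x).hasFDerivAt).smul (φ.hasFDerivAt x)
  rw [SchwartzMap.lineDerivOp_apply_eq_fderiv, hfun, hd.fderiv]
  simp [mulInner_apply, mulNormSq_apply, SchwartzMap.lineDerivOp_apply_eq_fderiv,
    real_inner_comm]
  ring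

theorem mulNormSq_mulInner (w : E) (φ : 𝓢(E, ℂ)) :
    mulNormSq E (mulInner w φ) = mulInner w (mulNormSq E φ) := by
  ext x
  simp only [mulInner_apply, mulNormSq_apply]
  ring

theorem lineDerivOp_comm (v w : E) (φ : 𝓢(E, ℂ)) : ∂_{v} (∂_{w} φ) = ∂_{w} (∂_{v} φ) := by
  have key : ∀ (v w : E) (x : E), ∂_{v} (∂_{w} φ) x = fderiv ℝ (fderiv ℝ φ) x v w := by
    intro v w x
    rw [SchwartzMap.lineDerivOp_apply_eq_fderiv]
    have h : ((∂_{w} φ : 𝓢(E, ℂ)) : E → ℂ) = fun y => fderiv ℝ φ y w := by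
      ext y; rw [SchwartzMap.lineDerivOp_apply_eq_fderiv]
    have hd : DifferentiableAt ℝ (fderiv ℝ φ) x :=
      (ContDiff.fderiv_right (n := 2) (m := 1) (φ.smooth 2) one_add_one_eq_two.le).differentiable
        one_ne_zero x
    rw [h, fderiv_clm_apply hd (differentiableAt_const w)]
    simp
  ext x
  rw [key, key]
  have : IsSymmSndFDerivAt ℝ φ x :=
    ContDiffAt.isSymmSndFDerivAt (n := 2) (φ.smooth 2).contDiffAt (by simp)
  exact this v w

theorem lineDerivOp_gaussian (v : E) : ∂_{v} (gaussian E) = -mulInner v (gaussian E) := by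
  ext x
  have h1 : HasFDerivAt (fun x : E => Real.exp (-(‖x‖ ^ 2 / 2)))
      (Real.exp (-(‖x‖ ^ 2 / 2)) • (-innerSL ℝ x)) x := by
    have := (((hasStrictFDerivAt_norm_sq x).hasFDerivAt).const_mul (1 / 2 : ℝ)).neg.exp
    convert this using 1
    · funext y
      simp only [Pi.neg_apply]
      congr 1
      ring
    · ext y
      have e : -(‖x‖ ^ 2 / 2) = -(2⁻¹ * ‖x‖ ^ 2) := by ring
      simp [e]
  have h2 := Complex.ofRealCLM.hasFDerivAt.comp x h1
  rw [SchwartzMap.lineDerivOp_apply_eq_fderiv]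
  have hfun : (gaussian E : E → ℂ) = Complex.ofRealCLM ∘ fun x : E => Real.exp (-(‖x‖ ^ 2 / 2)) :=
    rfl
  rw [hfun, h2.fderiv]
  simp [mulInner_apply, gaussian_apply, real_inner_comm]
  ring

/-- The creation operator `⟪w, x⟫ - ∂_w`. -/
noncomputable def creation (w : E) (φ : 𝓢(E, ℂ)) : 𝓢(E, ℂ) := mulInner w φ - ∂_{w} φ

/-- The annihilation operator `⟪w, x⟫ + ∂_w`. -/
noncomputable def annihilation (w : E) (φ : 𝓢(E, ℂ)) : 𝓢(E, ℂ) := mulInner w φ + ∂_{w} φ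

theorem lineDerivOp_real_smul (v : E) (c : ℝ) (φ : 𝓢(E, ℂ)) : ∂_{v} (c • φ) = c • ∂_{v} φ :=
  LineDeriv.lineDerivOp_smul ..

/-- The canonical commutation relation, from `[∂_w, ⟪w, ·⟫] = ‖w‖²`. It yields the lowering rule,
and with it the norms of the Hermite functions. -/
theorem annihilation_creation (w : E) (φ : 𝓢(E, ℂ)) :
    annihilation w (creation w φ) = creation w (annihilation w φ) + (2 * ‖w‖ ^ 2) • φ := by
  simp only [annihilation, creation, map_neg, map_add, sub_eq_add_neg, LineDeriv.lineDerivOp_neg,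
    LineDeriv.lineDerivOp_add, lineDerivOp_mulInner, real_inner_self_eq_norm_sq]
  module

theorem creation_smul (w : E) (c : ℝ) (φ : 𝓢(E, ℂ)) : creation w (c • φ) = c • creation w φ := by
  simp only [creation, map_smul, lineDerivOp_real_smul, smul_sub]

/-- The unnormalised Hermite functions in the direction `w`. -/
noncomputable def hermiteFun (w : E) : ℕ → 𝓢(E, ℂ)
  | 0 => gaussian E
  | k + 1 => creation w (hermiteFun w k)

theorem annihilation_hermiteFun_zero (w : E) : annihilation w (hermiteFun w 0) = 0 := by
  simp [annihilation, hermiteFun, lineDerivOp_gaussian]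

theorem annihilation_hermiteFun_succ {w : E} (hw : ‖w‖ = 1) (k : ℕ) :
    annihilation w (hermiteFun w (k + 1)) = (2 * (k + 1) : ℝ) • hermiteFun w k := by
  induction k with
  | zero =>
    change annihilation w (creation w (hermiteFun w 0)) = _
    rw [annihilation_creation, annihilation_hermiteFun_zero, hw]
    simp [creation, hermiteFun]
  | succ k ih =>
    rw [hermiteFun, annihilation_creation, ih, creation_smul, hw]
    change _ • hermiteFun w (k + 1) + _ = _
    push_cast
    module

variable [FiniteDimensional ℝ E]

theorem laplacian_mulInner (w : E) (φ : 𝓢(E, ℂ)) :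
    Δ (mulInner w φ) = mulInner w (Δ φ) + (2 : ℝ) • ∂_{w} φ := by
  have hw : ∂_{w} φ = ∑ i, ⟪w, stdOrthonormalBasis ℝ E i⟫_ℝ • ∂_{stdOrthonormalBasis ℝ E i} φ := by
    conv_lhs => rw [← (stdOrthonormalBasis ℝ E).sum_repr' w]
    ext x
    simp [SchwartzMap.lineDerivOp_apply_eq_fderiv, real_inner_comm]
  simp only [SchwartzMap.laplacian_eq_sum (stdOrthonormalBasis ℝ E), lineDerivOp_mulInner,
    LineDeriv.lineDerivOp_add, lineDerivOp_real_smul, map_sum, Finset.sum_add_distrib]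
  rw [hw]
  module

theorem laplacian_lineDerivOp (w : E) (φ : 𝓢(E, ℂ)) : Δ (∂_{w} φ) = ∂_{w} (Δ φ) := by
  simp only [SchwartzMap.laplacian_eq_sum (stdOrthonormalBasis ℝ E),
    LineDeriv.lineDerivOp_sum, lineDerivOp_comm _ w]

theorem laplacian_gaussian :
    Δ (gaussian E) = mulNormSq E (gaussian E) - (Module.finrank ℝ E : ℝ) • gaussian E := by
  simp only [SchwartzMap.laplacian_eq_sum (stdOrthonormalBasis ℝ E), lineDerivOp_gaussian,
    LineDeriv.lineDerivOp_neg, lineDerivOp_mulInner, map_neg]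
  ext x
  have h := (stdOrthonormalBasis ℝ E).sum_sq_inner_left x
  simp [mulInner_apply, mulNormSq_apply]
  rw [← Complex.ofReal_pow, ← h]
  push_cast
  rw [Finset.sum_mul, Finset.sum_add_distrib]
  simp only [Finset.sum_neg_distrib, real_inner_comm x, ← mul_assoc, ← pow_two]
  simp
  ring

end Schwartz

/-! ### Hermite functions as eigenfunctions of `H` -/

section Eigenfunctions

theorem hermiteOp_eq (n : ℕ) (φ : 𝓢(EuclideanSpace ℝ (Fin n), ℂ)) :
    hermiteOp n φ = -(Δ φ) + mulNormSq _ φ := rfl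

/-- Creation raises eigenvalues by 2: `[-Δ, ⟪w, ·⟫] = -2∂_w` and `[‖x‖², -∂_w] = 2⟪w, ·⟫`. -/
theorem hermiteOp_creation (n : ℕ) (w : EuclideanSpace ℝ (Fin n))
    (φ : 𝓢(EuclideanSpace ℝ (Fin n), ℂ)) :
    hermiteOp n (creation w φ) = creation w (hermiteOp n φ) + (2 : ℝ) • creation w φ := by
  have h : Δ (mulInner w φ - ∂_{w} φ) = Δ (mulInner w φ) - Δ (∂_{w} φ) := by
    simp only [← SchwartzMap.laplacianCLM_eq', map_sub]
  simp only [hermiteOp_eq, creation, h, laplacian_mulInner, laplacian_lineDerivOp, map_sub, map_add,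
    map_neg, LineDeriv.lineDerivOp_add, LineDeriv.lineDerivOp_neg, lineDerivOp_mulNormSq,
    mulNormSq_mulInner]
  module

theorem hermiteOp_hermiteFun (n : ℕ) (w : EuclideanSpace ℝ (Fin n)) (k : ℕ) :
    hermiteOp n (hermiteFun w k) = (2 * k + n : ℝ) • hermiteFun w k := by
  induction k with
  | zero =>
    simp only [hermiteOp_eq, hermiteFun, laplacian_gaussian, finrank_euclideanSpace_fin]
    push_cast
    module
  | succ k ih =>
    rw [hermiteFun, hermiteOp_creation, ih, creation_smul]
    push_cast
    module

end Eigenfunctions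

/-! ### Adjoints and norms in `L²` -/

section Inner

variable {E : Type*} [NormedAddCommGroup E] [InnerProductSpace ℝ E] [FiniteDimensional ℝ E]
  [MeasurableSpace E] [BorelSpace E]

/-- The complex inner product of `ℂ` as a real bilinear map. -/
noncomputable def innerBilin : ℂ →L[ℝ] ℂ →L[ℝ] ℂ :=
  (ContinuousLinearMap.mul ℝ ℂ).comp (Complex.conjCLE : ℂ →L[ℝ] ℂ)

theorem innerBilin_apply (x y : ℂ) : innerBilin x y = ⟪x, y⟫_ℂ := by
  simp [innerBilin, mul_comm]

theorem toLp_add (φ ψ : 𝓢(E, ℂ)) :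
    (φ + ψ).toLp 2 volume = φ.toLp 2 volume + ψ.toLp 2 volume :=
  map_add (SchwartzMap.toLpCLM ℂ ℂ 2 (volume : Measure E)) φ ψ

theorem toLp_sub (φ ψ : 𝓢(E, ℂ)) :
    (φ - ψ).toLp 2 volume = φ.toLp 2 volume - ψ.toLp 2 volume :=
  map_sub (SchwartzMap.toLpCLM ℂ ℂ 2 (volume : Measure E)) φ ψ

theorem toLp_neg (φ : 𝓢(E, ℂ)) : (-φ).toLp 2 volume = -φ.toLp 2 volume :=
  map_neg (SchwartzMap.toLpCLM ℂ ℂ 2 (volume : Measure E)) φ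

theorem toLp_real_smul (c : ℝ) (φ : 𝓢(E, ℂ)) :
    (c • φ).toLp 2 volume = (c : ℂ) • φ.toLp 2 volume :=
  map_smul (SchwartzMap.toLpCLM ℂ ℂ 2 (volume : Measure E)) (c : ℂ) φ

theorem inner_lineDerivOp (w : E) (φ ψ : 𝓢(E, ℂ)) :
    ⟪(∂_{w} φ).toLp 2 volume, ψ.toLp 2 volume⟫_ℂ =
      -⟪φ.toLp 2 volume, (∂_{w} ψ).toLp 2 volume⟫_ℂ := by
  simp only [SchwartzMap.inner_toL2_toL2_eq, ← innerBilin_apply]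
  rw [SchwartzMap.integral_bilinear_lineDerivOp_right_eq_neg_left, neg_neg]

theorem inner_laplacian (φ ψ : 𝓢(E, ℂ)) :
    ⟪(Δ φ).toLp 2 volume, ψ.toLp 2 volume⟫_ℂ = ⟪φ.toLp 2 volume, (Δ ψ).toLp 2 volume⟫_ℂ := by
  simp only [SchwartzMap.inner_toL2_toL2_eq, ← innerBilin_apply]
  rw [SchwartzMap.integral_bilinear_laplacian_right_eq_left]

theorem inner_mulInner (w : E) (φ ψ : 𝓢(E, ℂ)) :
    ⟪(mulInner w φ).toLp 2 volume, ψ.toLp 2 volume⟫_ℂ =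
      ⟪φ.toLp 2 volume, (mulInner w ψ).toLp 2 volume⟫_ℂ := by
  simp only [SchwartzMap.inner_toL2_toL2_eq, mulInner_apply, RCLike.inner_apply, map_mul,
    Complex.conj_ofReal]
  congr 1
  ext x
  ring

theorem inner_mulNormSq (φ ψ : 𝓢(E, ℂ)) :
    ⟪(mulNormSq E φ).toLp 2 volume, ψ.toLp 2 volume⟫_ℂ =
      ⟪φ.toLp 2 volume, (mulNormSq E ψ).toLp 2 volume⟫_ℂ := by
  simp only [SchwartzMap.inner_toL2_toL2_eq, mulNormSq_apply, RCLike.inner_apply, map_mul,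
    Complex.conj_ofReal]
  congr 1
  ext x
  ring

theorem inner_creation (w : E) (φ ψ : 𝓢(E, ℂ)) :
    ⟪φ.toLp 2 volume, (creation w ψ).toLp 2 volume⟫_ℂ =
      ⟪(annihilation w φ).toLp 2 volume, ψ.toLp 2 volume⟫_ℂ := by
  rw [creation, annihilation, toLp_sub, toLp_add, inner_sub_right, inner_add_left,
    inner_mulInner, inner_lineDerivOp, sub_eq_add_neg]

/-- Moving one creation operator across the inner product turns it into annihilation, which
contributes the factor `2 (k + 1)`. -/
theorem norm_hermiteFun_sq {w : E} (hw : ‖w‖ = 1) (k : ℕ) :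
    ‖(hermiteFun w k).toLp 2 volume‖ ^ 2 =
      2 ^ k * k.factorial * ‖(gaussian E).toLp 2 volume‖ ^ 2 := by
  induction k with
  | zero => simp [hermiteFun]
  | succ k ih =>
    have h : (‖(hermiteFun w (k + 1)).toLp 2 volume‖ ^ 2 : ℂ) =
        ((2 * (k + 1) * ‖(hermiteFun w k).toLp 2 volume‖ ^ 2 : ℝ) : ℂ) := by
      have h1 := inner_creation w (hermiteFun w (k + 1)) (hermiteFun w k)
      rw [annihilation_hermiteFun_succ hw, toLp_real_smul, inner_smul_left,
        inner_self_eq_norm_sq_to_K] at h1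
      change ⟪(hermiteFun w (k + 1)).toLp 2 volume, (hermiteFun w (k + 1)).toLp 2 volume⟫_ℂ = _
        at h1
      rw [inner_self_eq_norm_sq_to_K, Complex.conj_ofReal] at h1
      push_cast at h1 ⊢
      exact h1
    have h' : ‖(hermiteFun w (k + 1)).toLp 2 volume‖ ^ 2 =
        2 * (k + 1) * ‖(hermiteFun w k).toLp 2 volume‖ ^ 2 := by exact_mod_cast h
    rw [h', ih, Nat.factorial_succ]
    push_cast
    ring

end Inner

/-- `H` is symmetric on Schwartz functions, so a classical eigenfunction is one for the adjoint. -/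
theorem hermiteFun_mem_hermiteEigenspace (n : ℕ) (w : EuclideanSpace ℝ (Fin n)) (k : ℕ) :
    (hermiteFun w k).toLp 2 volume ∈ hermiteEigenspace n (2 * (k : ℝ) + (n : ℝ)) := by
  intro φ
  have h : ⟪(hermiteOp n φ).toLp 2 volume, (hermiteFun w k).toLp 2 volume⟫_ℂ =
      ⟪φ.toLp 2 volume, (hermiteOp n (hermiteFun w k)).toLp 2 volume⟫_ℂ := by
    simp only [hermiteOp_eq, toLp_add, toLp_neg, inner_add_left, inner_add_right, inner_neg_left,
      inner_neg_right, inner_laplacian, inner_mulNormSq]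
  rw [h, hermiteOp_hermiteFun, toLp_real_smul, inner_smul_right]

/-! ### The Hermite generating function -/

section GeneratingFunction

open Polynomial in
/-- The (physicists') Hermite polynomials. -/
noncomputable def hermitePoly : ℕ → ℂ[X]
  | 0 => 1
  | k + 1 => 2 * X * hermitePoly k - derivative (hermitePoly k)

theorem iteratedDeriv_cexp_neg_sq (k : ℕ) :
    iteratedDeriv k (fun t : ℂ => Complex.exp (-t ^ 2)) =
      fun t => (-1) ^ k * (hermitePoly k).eval t * Complex.exp (-t ^ 2) := by
  induction k with
  | zero => simp [hermitePoly]
  | succ k ih =>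
    rw [iteratedDeriv_succ, ih]
    funext t
    have h1 := (((hermitePoly k).hasDerivAt t).const_mul ((-1 : ℂ) ^ k)).mul
      ((hasDerivAt_pow 2 t).neg.cexp)
    refine h1.deriv.trans ?_
    simp [hermitePoly]
    ring

/-- Taylor expansion of `exp (-t²)` about `s`, evaluated at `s - z / 2` and multiplied by `exp
(s²)`; Rodrigues' formula identifies the coefficients. -/
theorem hasSum_hermitePoly (s z : ℂ) :
    HasSum (fun k : ℕ => (z / 2) ^ k / k.factorial * (hermitePoly k).eval s)
      (Complex.exp (z * s - z ^ 2 / 4)) := by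
  have h := (Complex.hasSum_taylorSeries_of_entire
    (f := fun t : ℂ => Complex.exp (-t ^ 2)) (by fun_prop) s (s - z / 2)).mul_left
    (Complex.exp (s ^ 2))
  have hexp : Complex.exp (s ^ 2) * Complex.exp (-(s - z / 2) ^ 2) =
      Complex.exp (z * s - z ^ 2 / 4) := by
    rw [← Complex.exp_add]
    congr 1
    ring
  rw [hexp] at h
  refine (congrArg (fun u : ℕ → ℂ => HasSum u _) (funext fun k => ?_)).mpr h
  rw [iteratedDeriv_cexp_neg_sq]
  have e : Complex.exp (s ^ 2) * Complex.exp (-s ^ 2) = 1 := by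
    rw [← Complex.exp_add]; simp
  have e' : (s - z / 2 - s) ^ k = (-1) ^ k * (z / 2) ^ k := by
    rw [← mul_pow]; ring
  have e2 : ((-1 : ℂ) ^ k) * (-1) ^ k = 1 := by rw [← mul_pow]; simp
  simp only [smul_eq_mul, e']
  linear_combination -((z / 2) ^ k * (k.factorial : ℂ)⁻¹ * (hermitePoly k).eval s) * e -
    (z / 2) ^ k * (k.factorial : ℂ)⁻¹ * (hermitePoly k).eval s *
      (Complex.exp (s ^ 2) * Complex.exp (-s ^ 2)) * e2

variable {E : Type*} [NormedAddCommGroup E] [InnerProductSpace ℝ E]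

theorem hermiteFun_apply {w : E} (hw : ‖w‖ = 1) (k : ℕ) (x : E) :
    hermiteFun w k x = (hermitePoly k).eval (⟪w, x⟫_ℝ : ℂ) * gaussian E x := by
  induction k generalizing x with
  | zero => simp [hermiteFun, hermitePoly]
  | succ k ih =>
    change creation w (hermiteFun w k) x = _
    have hfun : (hermiteFun w k : E → ℂ) =
        (fun x : E => (hermitePoly k).eval (⟪w, x⟫_ℝ : ℂ)) * (gaussian E : E → ℂ) :=
      funext ih
    have h1 : HasFDerivAt (fun x : E => (hermitePoly k).eval (⟪w, x⟫_ℝ : ℂ))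
        ((innerSL ℝ w).smulRight ((Polynomial.derivative (hermitePoly k)).eval (⟪w, x⟫_ℝ : ℂ)))
        x := by
      have h0 := ((hermitePoly k).hasDerivAt (⟪w, x⟫_ℝ : ℂ)).comp_ofReal
      refine (h0.hasFDerivAt.comp x ((innerSL ℝ w).hasFDerivAt (x := x))).congr_fderiv ?_
      ext y
      simp
    have h2 := h1.mul ((gaussian E).hasFDerivAt x)
    have hg : fderiv ℝ (gaussian E) x w = -(⟪w, x⟫_ℝ * gaussian E x) := by
      rw [← SchwartzMap.lineDerivOp_apply_eq_fderiv, lineDerivOp_gaussian, _root_.neg_apply,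
        mulInner_apply]
    rw [creation, _root_.sub_apply, mulInner_apply, SchwartzMap.lineDerivOp_apply_eq_fderiv, ih,
      hfun, h2.fderiv]
    simp [hg, hermitePoly, hw]
    ring

theorem hasSum_hermiteFun {w : E} (hw : ‖w‖ = 1) (z : ℂ) (x : E) :
    HasSum (fun k : ℕ => (z / 2) ^ k / k.factorial * hermiteFun w k x)
      (Complex.exp (z * ⟪w, x⟫_ℝ - z ^ 2 / 4) * gaussian E x) := by
  simp only [hermiteFun_apply hw, ← mul_assoc]
  exact (hasSum_hermitePoly _ z).mul_right _

end GeneratingFunction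

/-! ### Growth of generating series -/

section Series

/-- A term of the generating series, bounded by a geometric term times a Gaussian. -/
theorem norm_series_term_le {D ρ θ : ℝ} (hθ : 0 < θ) (hD : 0 ≤ D)
    {c : ℂ} {k : ℕ} (hc : ‖c‖ ≤ D * ρ ^ k * √(2 ^ k * k.factorial)) (z : ℂ) :
    ‖(z / 2) ^ k / k.factorial * c‖ ≤
      D * θ ^ k * Real.exp (ρ ^ 2 / (4 * θ ^ 2) * ‖z‖ ^ 2) := by
  set y := ρ ^ 2 / (4 * θ ^ 2) * ‖z‖ ^ 2 with hy
  have hfac : (2 * y) ^ k / k.factorial ≤ Real.exp (2 * y) :=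
    Real.pow_div_factorial_le_exp _ (by positivity) k
  have hmain : (‖z‖ / 2) ^ k / k.factorial * (ρ ^ k * √(2 ^ k * k.factorial)) ≤
      θ ^ k * Real.exp y := by
    -- Squaring removes the root and leaves a single `1 / k!`, so the exponential series at `2 * y`
    -- applies. The factor `θ ^ k` is split off for summability, at the price of `θ⁻²` in the type.
    refine le_of_sq_le_sq ?_ (by positivity)
    calc ((‖z‖ / 2) ^ k / k.factorial * (ρ ^ k * √(2 ^ k * k.factorial))) ^ 2
        = (((‖z‖ / 2) ^ k) ^ 2 * (ρ ^ k) ^ 2 * 2 ^ k) / k.factorial := by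
          rw [mul_pow, div_pow, mul_pow, Real.sq_sqrt (by positivity)]
          field_simp
      _ = (θ ^ k) ^ 2 * ((2 * y) ^ k / k.factorial) := by
          rw [← mul_div_assoc]
          congr 1
          have e : ∀ s : ℝ, (s ^ k) ^ 2 = (s ^ 2) ^ k := fun s => by
            rw [← pow_mul, ← pow_mul, mul_comm]
          have e' : θ ^ 2 * (2 * y) = (‖z‖ / 2) ^ 2 * ρ ^ 2 * 2 := by
            rw [hy]
            field_simp
            ring
          rw [e, e, e, ← mul_pow (θ ^ 2), e', mul_pow, mul_pow]
      _ ≤ (θ ^ k) ^ 2 * Real.exp (2 * y) := by gcongr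
      _ = (θ ^ k * Real.exp y) ^ 2 := by
          rw [mul_pow, ← Real.exp_nat_mul]; norm_num
  calc ‖(z / 2) ^ k / k.factorial * c‖ = (‖z‖ / 2) ^ k / k.factorial * ‖c‖ := by simp
    _ ≤ (‖z‖ / 2) ^ k / k.factorial * (D * ρ ^ k * √(2 ^ k * k.factorial)) := by gcongr
    _ = D * ((‖z‖ / 2) ^ k / k.factorial * (ρ ^ k * √(2 ^ k * k.factorial))) := by ring
    _ ≤ D * (θ ^ k * Real.exp y) := by gcongr
    _ = _ := by ring

/-- The exponential generating function of a sequence. -/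
noncomputable def genFun (c : ℕ → ℂ) (z : ℂ) : ℂ := ∑' k : ℕ, (z / 2) ^ k / k.factorial * c k

variable {c : ℕ → ℂ} {D ρ : ℝ}

theorem norm_genFun_le (hD : 0 ≤ D)
    (hc : ∀ k, ‖c k‖ ≤ D * ρ ^ k * √(2 ^ k * k.factorial)) {θ : ℝ} (hθ : 0 < θ) (hθ1 : θ < 1)
    (z : ℂ) :
    ‖genFun c z‖ ≤ D * (1 - θ)⁻¹ * Real.exp (ρ ^ 2 / (4 * θ ^ 2) * ‖z‖ ^ 2) := by
  have h := ((hasSum_geometric_of_lt_one hθ.le hθ1).mul_left D).mul_right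
    (Real.exp (ρ ^ 2 / (4 * θ ^ 2) * ‖z‖ ^ 2))
  exact tsum_of_norm_bounded h fun k => norm_series_term_le hθ hD (hc k) z

theorem differentiable_genFun (hD : 0 ≤ D)
    (hc : ∀ k, ‖c k‖ ≤ D * ρ ^ k * √(2 ^ k * k.factorial)) : Differentiable ℂ (genFun c) := by
  intro z
  have h := ((hasSum_geometric_of_lt_one (r := (1 / 2 : ℝ)) (by norm_num)
    (by norm_num)).mul_left D).mul_right
    (Real.exp (ρ ^ 2 / (4 * (1 / 2) ^ 2) * (‖z‖ + 1) ^ 2))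
  have hd : DifferentiableOn ℂ (genFun c) (Metric.ball 0 (‖z‖ + 1)) := by
    refine Complex.differentiableOn_tsum_of_summable_norm h.summable
      (fun k => by fun_prop) Metric.isOpen_ball fun k y hy => ?_
    refine (norm_series_term_le one_half_pos hD (hc k) y).trans ?_
    have : ‖y‖ ≤ ‖z‖ + 1 := (mem_ball_zero_iff.1 hy).le
    gcongr
  exact hd.differentiableAt (Metric.isOpen_ball.mem_nhds (by simp))

end Series

/-! ### Hermite coefficients of an `L²` function -/

theorem integral_norm_inner_le {α : Type*} [MeasurableSpace α] {μ : Measure α}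
    (f g : Lp ℂ 2 μ) : ∫ x, ‖⟪f x, g x⟫_ℂ‖ ∂μ ≤ ‖f‖ * ‖g‖ := by
  have h := eLpNorm_le_eLpNorm_mul_eLpNorm'_of_norm (p := 2) (q := 2) (r := 1)
    (Lp.aestronglyMeasurable f) (Lp.aestronglyMeasurable g) (fun x y : ℂ => ⟪x, y⟫_ℂ) 1
    (Filter.Eventually.of_forall fun x => by simp [mul_comm])
  rw [integral_norm_eq_lintegral_enorm (L2.integrable_inner f g).aestronglyMeasurable,
    ← eLpNorm_one_eq_lintegral_enorm, Lp.norm_def, Lp.norm_def, ← ENNReal.toReal_mul]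
  refine ENNReal.toReal_mono (ENNReal.mul_ne_top (Lp.eLpNorm_ne_top f) (Lp.eLpNorm_ne_top g)) ?_
  simpa using h

variable {n : ℕ}

/-- The unnormalised Hermite coefficients of `f` in the direction `w`. -/
noncomputable def hermiteCoeff (f : L2 n) (w : EuclideanSpace ℝ (Fin n)) (k : ℕ) : ℂ :=
  ⟪f, (hermiteFun w k).toLp 2 volume⟫_ℂ

theorem norm_hermiteFun {w : EuclideanSpace ℝ (Fin n)} (hw : ‖w‖ = 1) (k : ℕ) :
    ‖(hermiteFun w k).toLp 2 volume‖ =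
      √(2 ^ k * k.factorial) * ‖(gaussian (EuclideanSpace ℝ (Fin n))).toLp 2 volume‖ := by
  rw [← Real.sqrt_sq (norm_nonneg ((hermiteFun w k).toLp 2 volume)), norm_hermiteFun_sq hw,
    Real.sqrt_mul (by positivity), Real.sqrt_sq (norm_nonneg _)]

/-- The Hermite function is fixed by the self-adjoint projection, which can be moved onto `f` before
Cauchy–Schwarz. -/
theorem norm_hermiteCoeff_le {w : EuclideanSpace ℝ (Fin n)} (hw : ‖w‖ = 1) (f : L2 n) (k : ℕ) :
    ‖hermiteCoeff f w k‖ ≤ ‖hermiteProj n k f‖ *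
      ‖(gaussian (EuclideanSpace ℝ (Fin n))).toLp 2 volume‖ * √(2 ^ k * k.factorial) := by
  have h : hermiteCoeff f w k =
      ⟪hermiteProj n k f, (hermiteFun w k).toLp 2 volume⟫_ℂ := by
    have hmem : (hermiteFun w k).toLp 2 volume ∈
        (hermiteEigenspace n (2 * (k : ℝ) + (n : ℝ))).toSubmodule :=
      hermiteFun_mem_hermiteEigenspace n w k
    rw [hermiteProj, Submodule.inner_starProjection_left_eq_right,
      Submodule.starProjection_eq_self_iff.2 hmem, hermiteCoeff]
  rw [h]
  refine (norm_inner_le_norm _ _).trans_eq ?_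
  rw [norm_hermiteFun hw]
  ring

theorem genFun_hermiteCoeff {w : EuclideanSpace ℝ (Fin n)} (hw : ‖w‖ = 1) (f : L2 n) (z : ℂ) :
    genFun (hermiteCoeff f w) z = ∫ x, Complex.exp (z * ⟪w, x⟫_ℝ - z ^ 2 / 4) *
      (gaussian (EuclideanSpace ℝ (Fin n)) x * (starRingEnd ℂ) (f x)) := by
  set N := ‖(gaussian (EuclideanSpace ℝ (Fin n))).toLp 2 volume‖
  have hint : ∀ k, Integrable (fun x => (z / 2) ^ k / k.factorial *
      ⟪f x, (hermiteFun w k).toLp 2 volume x⟫_ℂ) := fun k =>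
    (L2.integrable_inner f _).const_mul _
  have hsum := hasSum_integral_of_summable_integral_norm hint (by
    refine Summable.of_nonneg_of_le (fun k => integral_nonneg fun x => norm_nonneg _) (fun k => ?_)
      (((summable_geometric_of_lt_one (r := (1 / 2 : ℝ)) (by norm_num)
        (by norm_num)).mul_left (‖f‖ * N)).mul_right
        (Real.exp (1 ^ 2 / (4 * (1 / 2) ^ 2) * ‖z‖ ^ 2)))
    -- Cauchy–Schwarz for the integral of the absolute value gives the coefficient bound with `ρ =
    -- 1`, enough for exchanging sum and integral at every `z`.
    have h := norm_series_term_le (D := ‖f‖ * N) (ρ := 1) (θ := 1 / 2)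
      (c := (∫ x, ‖⟪f x, (hermiteFun w k).toLp 2 volume x⟫_ℂ‖ : ℝ)) (k := k)
      one_half_pos (by positivity) (by
        rw [Complex.norm_real, Real.norm_of_nonneg (integral_nonneg fun x => norm_nonneg _)]
        refine (integral_norm_inner_le _ _).trans_eq ?_
        rw [norm_hermiteFun hw]
        ring) z
    refine le_trans (le_of_eq ?_) h
    simp only [norm_mul]
    rw [integral_const_mul, Complex.norm_real,
      Real.norm_of_nonneg (integral_nonneg fun x => by positivity)])
  have hc : ∀ k, ∫ x, (z / 2) ^ k / k.factorial * ⟪f x, (hermiteFun w k).toLp 2 volume x⟫_ℂ =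
      (z / 2) ^ k / k.factorial * hermiteCoeff f w k := fun k => by
    rw [integral_const_mul, hermiteCoeff, L2.inner_def]
  simp only [hc] at hsum
  rw [genFun, hsum.tsum_eq]
  refine integral_congr_ae ?_
  filter_upwards [ae_all_iff.2 fun k => (hermiteFun w k).coeFn_toLp 2 volume] with x hx
  have h := (hasSum_hermiteFun hw z x).mul_right ((starRingEnd ℂ) (f x))
  rw [← mul_assoc, ← h.tsum_eq]
  simp only [hx, RCLike.inner_apply, mul_assoc]

/-! ### Gaussian integrals and decay on the real axis -/

section Gauss

variable {E : Type*} [NormedAddCommGroup E] [InnerProductSpace ℝ E] [FiniteDimensional ℝ E]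
  [MeasurableSpace E] [BorelSpace E]

theorem integrable_exp_neg_mul_norm_sq {B : ℝ} (hB : 0 < B) :
    Integrable (fun x : E => Real.exp (-B * ‖x‖ ^ 2)) := by
  have h := (GaussianFourier.integrable_cexp_neg_mul_sq_norm_add (V := E) (b := B)
    (by simpa using hB) 0 0).norm
  refine h.congr (Filter.Eventually.of_forall fun x => ?_)
  simp [Complex.norm_exp, ← Complex.ofReal_pow]

omit [FiniteDimensional ℝ E] [MeasurableSpace E] [BorelSpace E] in
theorem exp_neg_mul_norm_sq_add {B : ℝ} (hB : 0 < B) {w : E} (hw : ‖w‖ = 1) (t : ℝ) (x : E) :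
    Real.exp (-B * ‖x‖ ^ 2 + t * ⟪w, x⟫_ℝ) =
      Real.exp (t ^ 2 / (4 * B)) * Real.exp (-B * ‖x - (t / (2 * B)) • w‖ ^ 2) := by
  rw [← Real.exp_add, norm_sub_sq_real, norm_smul, inner_smul_right, hw, real_inner_comm,
    Real.norm_eq_abs, mul_one, sq_abs]
  congr 1
  field_simp
  ring

theorem integrable_exp_neg_mul_norm_sq_add {B : ℝ} (hB : 0 < B) {w : E} (hw : ‖w‖ = 1) (t : ℝ) :
    Integrable (fun x : E => Real.exp (-B * ‖x‖ ^ 2 + t * ⟪w, x⟫_ℝ)) := by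
  simp only [exp_neg_mul_norm_sq_add hB hw]
  exact ((integrable_exp_neg_mul_norm_sq hB).comp_sub_right _).const_mul _

theorem integral_exp_neg_mul_norm_sq_add {B : ℝ} (hB : 0 < B) {w : E} (hw : ‖w‖ = 1) (t : ℝ) :
    ∫ x : E, Real.exp (-B * ‖x‖ ^ 2 + t * ⟪w, x⟫_ℝ) =
      Real.exp (t ^ 2 / (4 * B)) * ∫ x : E, Real.exp (-B * ‖x‖ ^ 2) := by
  simp only [exp_neg_mul_norm_sq_add hB hw]
  rw [integral_const_mul, integral_sub_right_eq_self (fun x : E => Real.exp (-B * ‖x‖ ^ 2))]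

end Gauss

/-- Completing the square gives the exponent `t² / (2 (1 + a)) - t² / 4`, which is `-(a - 1) / (4 (a
+ 1)) t²`. -/
theorem norm_genFun_hermiteCoeff_ofReal_le {w : EuclideanSpace ℝ (Fin n)} (hw : ‖w‖ = 1)
    {f : L2 n} {a C : ℝ} (ha : 0 < a)
    (hf : ∀ᵐ x : EuclideanSpace ℝ (Fin n), ‖f x‖ ≤ C * Real.exp (-(1 / 2) * a * ‖x‖ ^ 2))
    (t : ℝ) :
    ‖genFun (hermiteCoeff f w) t‖ ≤
      (C * ∫ x : EuclideanSpace ℝ (Fin n), Real.exp (-((1 + a) / 2) * ‖x‖ ^ 2)) *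
        Real.exp (-((a - 1) / (4 * (a + 1))) * t ^ 2) := by
  have hB : 0 < (1 + a) / 2 := by positivity
  rw [genFun_hermiteCoeff hw]
  have hle := norm_integral_le_of_norm_le
    ((integrable_exp_neg_mul_norm_sq_add hB hw t).const_mul (C * Real.exp (-(t ^ 2 / 4))))
    (f := fun x => Complex.exp ((t : ℂ) * ⟪w, x⟫_ℝ - (t : ℂ) ^ 2 / 4) *
      (gaussian (EuclideanSpace ℝ (Fin n)) x * (starRingEnd ℂ) (f x))) (by
    filter_upwards [hf] with x hx
    have e : ((t : ℂ) * ⟪w, x⟫_ℝ - (t : ℂ) ^ 2 / 4) = ((t * ⟪w, x⟫_ℝ - t ^ 2 / 4 : ℝ) : ℂ) := by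
      push_cast; ring
    rw [norm_mul, norm_mul, gaussian_apply, Complex.norm_real, RCLike.norm_conj, e,
      Complex.norm_exp_ofReal, Real.norm_eq_abs, Real.abs_exp]
    calc Real.exp (t * ⟪w, x⟫_ℝ - t ^ 2 / 4) * (Real.exp (-(‖x‖ ^ 2 / 2)) * ‖f x‖)
        ≤ Real.exp (t * ⟪w, x⟫_ℝ - t ^ 2 / 4) * (Real.exp (-(‖x‖ ^ 2 / 2)) *
          (C * Real.exp (-(1 / 2) * a * ‖x‖ ^ 2))) := by gcongr
      _ = C * (Real.exp (t * ⟪w, x⟫_ℝ - t ^ 2 / 4) * Real.exp (-(‖x‖ ^ 2 / 2)) *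
          Real.exp (-(1 / 2) * a * ‖x‖ ^ 2)) := by ring
      _ = C * (Real.exp (-(t ^ 2 / 4)) *
          Real.exp (-((1 + a) / 2) * ‖x‖ ^ 2 + t * ⟪w, x⟫_ℝ)) := by
        rw [← Real.exp_add, ← Real.exp_add, ← Real.exp_add]
        congr 2
        ring
      _ = _ := by ring)
  refine hle.trans_eq ?_
  rw [integral_const_mul, integral_exp_neg_mul_norm_sq_add hB hw]
  have e : Real.exp (-((a - 1) / (4 * (a + 1))) * t ^ 2) =
      Real.exp (-(t ^ 2 / 4)) * Real.exp (t ^ 2 / (4 * ((1 + a) / 2))) := by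
    rw [← Real.exp_add]
    congr 1
    have : a + 1 ≠ 0 := by positivity
    have : 1 + a ≠ 0 := by positivity
    field_simp
    ring
  rw [e]
  ring

/-! ### Injectivity of the Fourier transform -/

open FourierTransform in
/-- An integrable function with vanishing Fourier transform vanishes almost everywhere. -/
theorem ae_eq_zero_of_fourier_eq_zero {E : Type*} [NormedAddCommGroup E] [InnerProductSpace ℝ E]
    [FiniteDimensional ℝ E] [MeasurableSpace E] [BorelSpace E] {u : E → ℂ} (hu : Integrable u)
    (h : ∀ ξ : E, ∫ x, Complex.exp (⟪ξ, x⟫_ℝ * Complex.I) * u x = 0) : ∀ᵐ x, u x = 0 := by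
  have hF : VectorFourier.fourierIntegral 𝐞 volume (innerₗ E).flip u = 0 := by
    funext ξ
    rw [VectorFourier.fourierIntegral, Pi.zero_apply, ← h ((-(2 * Real.pi)) • ξ)]
    refine integral_congr_ae (Filter.Eventually.of_forall fun x => ?_)
    simp only [Circle.smul_def, Real.fourierChar_apply, smul_eq_mul, LinearMap.flip_apply,
      innerₗ_apply_apply, real_inner_smul_left]
    congr 2
    push_cast
    ring
  refine ae_eq_zero_of_integral_contDiff_smul_eq_zero hu.locallyIntegrable fun g hg hgc => ?_
  have hgc' : HasCompactSupport (fun x => (g x : ℂ)) := hgc.comp_left Complex.ofReal_zero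
  have hg' : ContDiff ℝ ∞ (fun x => (g x : ℂ)) := Complex.ofRealCLM.contDiff.comp hg
  set ψ : 𝓢(E, ℂ) := hgc'.toSchwartzMap hg'
  have hψg : ∀ x, ψ x = g x := fun x => rfl
  -- Multiplication formula: writing the test function `g` as the transform of `𝓕⁻ ψ` moves the
  -- transform onto `u`, where it vanishes.
  have key := VectorFourier.integral_fourierIntegral_smul_eq_flip (μ := volume) (ν := volume)
    (L := innerₗ E) Real.continuous_fourierChar continuous_inner (𝓕⁻ ψ).integrable hu
  rw [hF] at key
  have hinv : ∀ x, VectorFourier.fourierIntegral 𝐞 volume (innerₗ E) (𝓕⁻ ψ : 𝓢(E, ℂ)) x = (g x : ℂ) := by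
    intro x
    have h1 : 𝓕 (𝓕⁻ ψ) = ψ := FourierTransform.fourier_fourierInv_eq ψ
    have h2 : 𝓕 (𝓕⁻ ψ) x = ψ x := by rw [h1]
    rw [← hψg, ← h2]
    rfl
  simp only [hinv] at key
  simpa using key

end HermiteExpansion

/-! ### Hardy's theorem -/

theorem mainTheorem6 (n : ℕ) (hn : 1 ≤ n) (f : HermiteExpansion.L2 n) (a b C : ℝ)
    (ha : 0 < a) (hb : 0 < b)
    (hf : ∀ᵐ x : EuclideanSpace ℝ (Fin n), ‖f x‖ ≤ C * Real.exp (-(1 / 2) * a * ‖x‖ ^ 2))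
    (hPf : ∀ k : ℕ, ‖HermiteExpansion.hermiteProj n k f‖ ≤
      C * Real.exp (-(1 / 2) * b * (2 * (k : ℝ) + (n : ℝ))))
    (hab : 1 < a * Real.tanh b) :
    f = 0 := by
  open HermiteExpansion in
  have hC : 0 ≤ C := by
    have h := (norm_nonneg _).trans (hPf 0)
    exact nonneg_of_mul_nonneg_left h (Real.exp_pos _)
  set q := Real.exp (-b) ^ 2 with hq
  have hq0 : 0 < q := by positivity
  have hqr : q < (a - 1) / (a + 1) := by
    have htanh : Real.tanh b = (1 - q) / (1 + q) := by
      rw [Real.tanh_eq_sinh_div_cosh, Real.sinh_eq, Real.cosh_eq, hq]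
      have e : Real.exp b * Real.exp (-b) = 1 := by rw [← Real.exp_add]; simp
      have := Real.exp_pos b
      have := Real.exp_pos (-b)
      rw [div_div_div_cancel_right₀ two_ne_zero, div_eq_div_iff (by positivity) (by positivity)]
      linear_combination (2 * Real.exp (-b)) * e
    rw [htanh, ← mul_div_assoc, lt_div_iff₀ (by positivity)] at hab
    rw [lt_div_iff₀ (by positivity)]
    linarith
  -- Room for the loss in the type: with `θ = √(q / q') < 1`, the type `q / (4 θ²)` is `q' / 4`,
  -- still below the decay rate.
  obtain ⟨q', hqq', hq'r⟩ := exists_between hqr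
  have hq'0 : 0 < q' := hq0.trans hqq'
  have hθ1 : √(q / q') < 1 := by
    rw [Real.sqrt_lt' zero_lt_one, one_pow]
    exact (div_lt_one hq'0).2 hqq'
  have hθ : 0 < √(q / q') := Real.sqrt_pos.2 (by positivity)
  set N := ‖(gaussian (EuclideanSpace ℝ (Fin n))).toLp 2 volume‖
  have hzero : ∀ w : EuclideanSpace ℝ (Fin n), ‖w‖ = 1 → genFun (hermiteCoeff f w) = 0 := by
    intro w hw
    have hc : ∀ k, ‖hermiteCoeff f w k‖ ≤
        (C * N) * Real.exp (-b) ^ k * √(2 ^ k * k.factorial) := by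
      intro k
      refine (norm_hermiteCoeff_le hw f k).trans ?_
      -- The factor `e ^ (-bn / 2) ≤ 1` is dropped.
      have h1 : Real.exp (-(1 / 2) * b * (2 * (k : ℝ) + (n : ℝ))) ≤ Real.exp (-b) ^ k := by
        rw [← Real.exp_nat_mul, Real.exp_le_exp]
        have : 0 ≤ b * n := by positivity
        linarith
      calc ‖hermiteProj n k f‖ * N * √(2 ^ k * k.factorial)
          ≤ (C * Real.exp (-b) ^ k) * N * √(2 ^ k * k.factorial) := by
            gcongr
            exact (hPf k).trans (by gcongr)
        _ = _ := by ring
    set K := C * N * (1 - √(q / q'))⁻¹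
    set K' := C * ∫ x : EuclideanSpace ℝ (Fin n), Real.exp (-((1 + a) / 2) * ‖x‖ ^ 2)
    refine eq_zero_of_gaussian_decay (C := max K K') (β := q' / 4) (α := (a - 1) / (4 * (a + 1)))
      (differentiable_genFun (by positivity) hc) ?_ ?_ ?_
    · intro z
      refine (norm_genFun_le (by positivity) hc hθ hθ1 z).trans ?_
      have e : Real.exp (-b) ^ 2 / (4 * √(q / q') ^ 2) = q' / 4 := by
        rw [Real.sq_sqrt (by positivity), ← hq]
        field_simp
      rw [e]
      gcongr
      exact le_max_left _ _
    · intro t _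
      refine (norm_genFun_hermiteCoeff_ofReal_le hw ha hf t).trans ?_
      gcongr
      exact le_max_right _ _
    · have e : (a - 1) / (4 * (a + 1)) = (a - 1) / (a + 1) / 4 := by
        rw [div_div, mul_comm]
      rw [e]
      gcongr
  have hker : ∀ᵐ x, gaussian (EuclideanSpace ℝ (Fin n)) x * (starRingEnd ℂ) (f x) = 0 := by
    refine ae_eq_zero_of_fourier_eq_zero ?_ fun ξ => ?_
    · refine (L2.integrable_inner (𝕜 := ℂ) f
        ((gaussian (EuclideanSpace ℝ (Fin n))).toLp 2 volume)).congr ?_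
      filter_upwards [(gaussian (EuclideanSpace ℝ (Fin n))).coeFn_toLp 2 volume] with x hx
      rw [hx, RCLike.inner_apply]
    · obtain ⟨w, hw, t, rfl⟩ : ∃ w : EuclideanSpace ℝ (Fin n), ‖w‖ = 1 ∧ ∃ t : ℝ, ξ = t • w := by
        have : NeZero n := ⟨by omega⟩
        by_cases hξ : ξ = 0
        · obtain ⟨w, hw⟩ := exists_norm_eq (EuclideanSpace ℝ (Fin n)) zero_le_one
          exact ⟨w, hw, 0, by simp [hξ]⟩
        · have hξ' : ‖ξ‖ ≠ 0 := norm_ne_zero_iff.2 hξ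
          exact ⟨‖ξ‖⁻¹ • ξ, norm_smul_inv_norm hξ, ‖ξ‖, by rw [smul_inv_smul₀ hξ']⟩
      -- At `z = it` the kernel is the Fourier character at `t • w`, times the nonzero constant `e ^
      -- (t² / 4)`.
      have h := congrFun (hzero w hw) (t * Complex.I)
      rw [genFun_hermiteCoeff hw, Pi.zero_apply] at h
      have h2 : Complex.exp (-((t : ℂ) * Complex.I) ^ 2 / 4) ≠ 0 := Complex.exp_ne_zero _
      suffices h3 : Complex.exp (-((t : ℂ) * Complex.I) ^ 2 / 4) * ∫ x,
          Complex.exp (⟪t • w, x⟫_ℝ * Complex.I) *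
            (gaussian (EuclideanSpace ℝ (Fin n)) x * (starRingEnd ℂ) (f x)) = 0 from
        (mul_eq_zero.1 h3).resolve_left h2
      rw [← integral_const_mul, ← h]
      refine integral_congr_ae (Filter.Eventually.of_forall fun x => ?_)
      simp only [real_inner_smul_left]
      rw [← mul_assoc, ← Complex.exp_add]
      congr 2
      push_cast
      ring
  rw [Lp.eq_zero_iff_ae_eq_zero]
  filter_upwards [hker] with x hx
  have hg : gaussian (EuclideanSpace ℝ (Fin n)) x ≠ 0 := by
    rw [gaussian_apply]
    exact_mod_cast (Real.exp_pos _).ne'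
  simpa using (mul_eq_zero.1 hx).resolve_left hg
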